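/- Consider oriented singular tangle diagrams in a disk, that is, generic immersed oriented arcs (with endpoints on the boundary) and circles, each double point of which is either an ordinary crossing (with over/under information) or a singular crossing (without it), up to planar isotopy fixing the boundary of the disk. The oriented singular Reidemeister moves are the following local replacements in a disk, usable in both directions and counted up to orientation-preserving planar isotopy of the disk (including rotations): - $\mathcal R\mathrm{I}$ (4 moves): removal of a curl, which turns to the left or to the right and has a positive or a negative crossing; - $\mathcal R\mathrm{II}$ (4 moves, 2a–2d): separation of two strands that bound a bigon and one of which lies over the other; - $\mathcal R\mathrm{III}$ (8 moves, 3a–3h): passage of a strand across an ordinary crossing of two others, the three strands lying at three different heights; - $\mathcal R\mathrm{IV}_O=\{4a,4b,4c,4d\}$ (resp. $\mathcal R\mathrm{IV}_U=\{4e,4f,4g,4h\}$): passage of a strand over (resp. under) a singular crossing of two others, for the four possible orientations; - $\mathcal R\mathrm{V}=\{5a,\dots,5f\}$: exchange of a singular crossing and an ordinary crossing that are joined by a bigon (the six possible choices of orientations and of the sign of the ordinary crossing). Put $\mathcal R=\mathcal R\mathrm{I}\cup\mathcal R\mathrm{II}\cup\mathcal R\mathrm{III}$ and $\mathcal{SR}=\mathcal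 R\mathrm{IV}_O\cup\mathcal R\mathrm{IV}_U\cup\mathcal R\mathrm{V}$. For a set $T$ of moves, a subset $S\subseteq T$ is a generating set of $T$ if, for every $m\in T$, the two sides of $m$ are related by a finite sequence of planar isotopies and of moves from $S$ inside the disk of $m$, with its boundary fixed. It is a minimal generating set if moreover, for every $m\in S$, the set $S\setminus\{m\}$ is not a generating set of $T$. **Theorem.** (1) A set $S$ is a minimal generating set of $\mathcal R\cup\mathcal{SR}$ if and only if there are a minimal generating set $M$ of $\mathcal R$ and moves $4{*}\in\mathcal R\mathrm{IV}_O$, $4\sharp\in\mathcal R\mathrm{IV}_U$, $5{\star}\in\mathcal R\mathrm V$ such that $S=M\cup\{4{*},4\sharp,5{\star}\}$. (2) Let $M$ be any minimal generating set of $\mathcal R$. The minimal generating sets of $\mathcal R\cup\mathcal{SR}$ that contain $M$ are exactly the sets $M\cup\{4{*},4\sharp,5{\star}\}$ with $4{*}\in\mathcal R\mathrm{IV}_O$, $4\sharp\in\mathcal R\mathrm{IV}_U$, $5{\star}\in\mathcal R\mathrm V$; there are exactly $4\times4\times6=96$ of them. Moreover, for $X\subseteq\mathcal{SR}$, the set $M\cup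 X$ is a minimal generating set of $\mathcal R\cup\mathcal{SR}$ if and only if $X=\{4{*},4\sharp,5{\star}\}$ for some such $4{*}$, $4\sharp$, $5{\star}$. -/

import Mathlib

namespace SingularTangle

/-! ## Oriented singular tangle diagrams in a disk

A diagram is drawn in a rectangle, in general position with respect to the height function, with its
endpoints on the bottom and top edges.  It is recorded as the list, from bottom to top, of its
elementary layers, each of which contains one local minimum, local maximum or crossing.
Knot and link diagrams are the diagrams without endpoints. -/

/-- The orientations of the strands met by a horizontal line, read from left to right
(`true` : upwards, `false` : downwards). -/
abbrev Word := List Bool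

/-- The three kinds of crossings of a strand rising to the right with a strand rising to the left:
the first one passes over, the second one passes over, or the crossing is singular. -/
inductive Kind
  | rightOver
  | leftOver
  | singular

/-- The effect on the kind of a quarter turn of the plane. -/
def Kind.turn : Kind → Kind
  | .rightOver => .leftOver
  | .leftOver => .rightOver
  | .singular => .singular

/-- The elementary pieces of a diagram.
* `cup a` : a local minimum whose left leg has orientation `a`;
* `cap a` : a local maximum whose left leg has orientation `a`;
* `cross k a b` : a crossing of kind `k`; the strand from bottom left to top right has
  orientation `a`, the strand from bottom right to top left has orientation `b`. -/
inductive Piece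
  | cup (a : Bool)
  | cap (a : Bool)
  | cross (k : Kind) (a b : Bool)

/-- Orientations at the bottom of an elementary piece. -/
def Piece.dom : Piece → Word
  | .cup _ => []
  | .cap a => [a, !a]
  | .cross _ a b => [a, b]

/-- Orientations at the top of an elementary piece. -/
def Piece.cod : Piece → Word
  | .cup a => [a, !a]
  | .cap _ => []
  | .cross _ a b => [b, a]

/-- An elementary piece with vertical strands to its left and to its right. -/
structure Layer where
  left : Word
  piece : Piece
  right : Word

def Layer.dom (L : Layer) : Word := L.left ++ (L.piece.dom ++ L.right)

def Layer.cod (L : Layer) : Word := L.left ++ (L.piece.cod ++ L.right)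

/-- The layers can be stacked, from the bottom word `u` to the top word `v`. -/
def Stacks : Word → List Layer → Word → Prop
  | u, [], v => u = v
  | u, L :: D, v => u = L.dom ∧ Stacks L.cod D v

/-- Oriented singular tangle diagrams with bottom endpoints `u` and top endpoints `v`. -/
@[ext]
structure Diagram (u v : Word) where
  layers : List Layer
  valid : Stacks u layers v

theorem Stacks.append {u v w : Word} {D E : List Layer} (hD : Stacks u D v) (hE : Stacks v E w) :
    Stacks u (D ++ E) w := by
  induction D generalizing u with
  | nil => cases hD; exact hE
  | cons L D ih => exact ⟨hD.1, ih hD.2⟩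

theorem Stacks.addLeft {u v : Word} {D : List Layer} (l : Word) (hD : Stacks u D v) :
    Stacks (l ++ u) (D.map fun L => ⟨l ++ L.left, L.piece, L.right⟩) (l ++ v) := by
  induction D generalizing u with
  | nil => cases hD; rfl
  | cons L D ih =>
    have h := ih hD.2
    refine ⟨?_, ?_⟩
    · rw [hD.1]; simp [Layer.dom]
    · simpa [Layer.cod] using h

theorem Stacks.addRight {u v : Word} {D : List Layer} (r : Word) (hD : Stacks u D v) :
    Stacks (u ++ r) (D.map fun L => ⟨L.left, L.piece, L.right ++ r⟩) (v ++ r) := by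
  induction D generalizing u with
  | nil => cases hD; rfl
  | cons L D ih =>
    have h := ih hD.2
    refine ⟨?_, ?_⟩
    · rw [hD.1]; simp [Layer.dom]
    · simpa [Layer.cod] using h

namespace Diagram

/-- The diagram without crossings consisting of vertical strands. -/
def vertical (u : Word) : Diagram u u := ⟨[], rfl⟩

/-- Put `e` on top of `d`. -/
def stack {u v w : Word} (d : Diagram u v) (e : Diagram v w) : Diagram u w :=
  ⟨d.layers ++ e.layers, d.valid.append e.valid⟩

/-- Put vertical strands to the left of `d`. -/
def addLeft {u v : Word} (l : Word) (d : Diagram u v) : Diagram (l ++ u) (l ++ v) :=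
  ⟨d.layers.map fun L => ⟨l ++ L.left, L.piece, L.right⟩, d.valid.addLeft l⟩

/-- Put vertical strands to the right of `d`. -/
def addRight {u v : Word} (d : Diagram u v) (r : Word) : Diagram (u ++ r) (v ++ r) :=
  ⟨d.layers.map fun L => ⟨L.left, L.piece, L.right ++ r⟩, d.valid.addRight r⟩

end Diagram

open Diagram

/-! ## Planar isotopy

The events that change the list of layers during a generic planar isotopy of diagrams: two parts
of the diagram lying side by side exchange their heights; a local minimum and a local maximum that
are adjacent on a strand cancel or are created; a crossing passes through a local maximum or a
local minimum of one of its two strands. -/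

inductive ElementaryIsotopy : ∀ {u v : Word}, Diagram u v → Diagram u v → Prop
  | exchange {u v u' v' : Word} (d : Diagram u v) (e : Diagram u' v') :
      ElementaryIsotopy ((d.addRight u').stack (e.addLeft v)) ((e.addLeft u).stack (d.addRight v'))
  | cancelRight (a : Bool) :
      ElementaryIsotopy
        (⟨[⟨[a], .cup (!a), []⟩, ⟨[], .cap a, [a]⟩], by cases a <;> exact ⟨rfl, rfl, rfl⟩⟩ :
          Diagram [a] [a])
        (vertical [a])
  | cancelLeft (a : Bool) :
      ElementaryIsotopy
        (⟨[⟨[], .cup a, [a]⟩, ⟨[a], .cap (!a), []⟩], by cases a <;> exact ⟨rfl, rfl, rfl⟩⟩ :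
          Diagram [a] [a])
        (vertical [a])
  | throughCap (k : Kind) (a b : Bool) :
      ElementaryIsotopy
        (⟨[⟨[], .cross k a b, [!a]⟩, ⟨[b], .cap a, []⟩], ⟨rfl, rfl, rfl⟩⟩ :
          Diagram [a, b, !a] [b])
        ⟨[⟨[a], .cross k.turn b (!a), []⟩, ⟨[], .cap a, [b]⟩], ⟨rfl, rfl, rfl⟩⟩
  | throughCup (k : Kind) (a b : Bool) :
      ElementaryIsotopy
        (⟨[⟨[b], .cup a, []⟩, ⟨[], .cross k b a, [!a]⟩], ⟨rfl, rfl, rfl⟩⟩ :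
          Diagram [b] [a, b, !a])
        ⟨[⟨[], .cup a, [b]⟩, ⟨[a], .cross k.turn (!a) b, []⟩], ⟨rfl, rfl, rfl⟩⟩

/-! ## Oriented singular Reidemeister moves -/

/-- A local move: two diagrams in a disk with the same endpoints, which may replace each other. -/
structure LocalMove where
  bot : Word
  top : Word
  before : Diagram bot top
  after : Diagram bot top

/-- Type I: a curl on an upward strand, on its right side. -/
def curlRight (k : Kind) : LocalMove where
  bot := [true]
  top := [true]
  before := ⟨[⟨[true], .cup true, []⟩, ⟨[], .cross k true true, [false]⟩, ⟨[true], .cap true, []⟩],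
    ⟨rfl, rfl, rfl, rfl⟩⟩
  after := vertical _

/-- Type I: a curl on an upward strand, on its left side. -/
def curlLeft (k : Kind) : LocalMove where
  bot := [true]
  top := [true]
  before := ⟨[⟨[], .cup false, [true]⟩, ⟨[false], .cross k true true, []⟩,
    ⟨[], .cap false, [true]⟩], ⟨rfl, rfl, rfl, rfl⟩⟩
  after := vertical _

/-- Type II: two strands of orientations `a`, `b`, one of which lies over the other. -/
def bigon (a b : Bool) (k : Kind) : LocalMove where
  bot := [a, b]
  top := [a, b]
  before := ⟨[⟨[], .cross k a b, []⟩, ⟨[], .cross k.turn b a, []⟩], ⟨rfl, rfl, rfl⟩⟩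
  after := vertical _

/-- Types III and IV: three strands, of orientations `a`, `b`, `c` from left to right at the bottom,
cross pairwise; the strand in the middle is moved across the crossing of the other two. Here `p`,
`q`, `r` are the kinds of the crossings of the first and second, the first and third, and the second
and third strand. -/
def triangle (a b c : Bool) (p q r : Kind) : LocalMove where
  bot := [a, b, c]
  top := [c, b, a]
  before := ⟨[⟨[], .cross p a b, [c]⟩, ⟨[b], .cross q a c, []⟩, ⟨[], .cross r b c, [a]⟩],
    ⟨rfl, rfl, rfl, rfl⟩⟩
  after := ⟨[⟨[a], .cross r b c, []⟩, ⟨[], .cross q a c, [b]⟩, ⟨[c], .cross p a b, []⟩],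
    ⟨rfl, rfl, rfl, rfl⟩⟩

/-- Type V: a singular crossing and an ordinary crossing of the same two strands, which are adjacent
along both strands, change places. -/
def flip (a b : Bool) (k : Kind) : LocalMove where
  bot := [a, b]
  top := [a, b]
  before := ⟨[⟨[], .cross .singular a b, []⟩, ⟨[], .cross k b a, []⟩], ⟨rfl, rfl, rfl⟩⟩
  after := ⟨[⟨[], .cross k a b, []⟩, ⟨[], .cross .singular b a, []⟩], ⟨rfl, rfl, rfl⟩⟩

/-- The names of the oriented singular Reidemeister moves. -/
inductive Move
  | m1a | m1b | m1c | m1d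
  | m2a | m2b | m2c | m2d
  | m3a | m3b | m3c | m3d | m3e | m3f | m3g | m3h
  | m4a | m4b | m4c | m4d | m4e | m4f | m4g | m4h
  | m5a | m5b | m5c | m5d | m5e | m5f

open Kind in
/-- The oriented singular Reidemeister moves, one representative for each move up to rotations of
the disk. -/
def Move.toLocalMove : Move → LocalMove
  -- the four curls: loop on the right or on the left, positive or negative crossing
  | .m1a => curlLeft rightOver
  | .m1b => curlRight rightOver
  | .m1c => curlLeft leftOver
  | .m1d => curlRight leftOver
  -- two parallel strands, then two antiparallel strands
  | .m2a => bigon true true rightOver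
  | .m2b => bigon true true leftOver
  | .m2c => bigon true false rightOver
  | .m2d => bigon false true rightOver
  -- parallel strands in `m3b`, ..., `m3g`; alternating orientations in `m3a` and `m3h`;
  -- in each move one strand is above, one in the middle and one below
  | .m3a => triangle true false true rightOver rightOver rightOver
  | .m3b => triangle true true true rightOver rightOver rightOver
  | .m3c => triangle true true true rightOver rightOver leftOver
  | .m3d => triangle true true true leftOver rightOver rightOver
  | .m3e => triangle true true true rightOver leftOver leftOver
  | .m3f => triangle true true true leftOver leftOver rightOver
  | .m3g => triangle true true true leftOver leftOver leftOver
  | .m3h => triangle true false true leftOver leftOver leftOver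
  -- the middle strand passes over the singular crossing of the other two
  | .m4a => triangle true false true leftOver singular rightOver
  | .m4b => triangle true true false leftOver singular rightOver
  | .m4c => triangle true false false leftOver singular rightOver
  | .m4d => triangle true true true leftOver singular rightOver
  -- the middle strand passes under the singular crossing of the other two
  | .m4e => triangle true false true rightOver singular leftOver
  | .m4f => triangle true true false rightOver singular leftOver
  | .m4g => triangle true false false rightOver singular leftOver
  | .m4h => triangle true true true rightOver singular leftOver
  -- parallel strands in `m5a` and `m5d`, antiparallel strands in the others;
  -- the ordinary crossing is positive in `m5a`, `m5e`, `m5f` and negative in the others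
  | .m5a => flip true true rightOver
  | .m5b => flip true false rightOver
  | .m5c => flip false true rightOver
  | .m5d => flip true true leftOver
  | .m5e => flip true false leftOver
  | .m5f => flip false true leftOver

open Move

/-- The moves of type I. -/
def RI : Set Move := {m1a, m1b, m1c, m1d}

/-- The moves of type II. -/
def RII : Set Move := {m2a, m2b, m2c, m2d}

/-- The moves of type III. -/
def RIII : Set Move := {m3a, m3b, m3c, m3d, m3e, m3f, m3g, m3h}

/-- The moves of type IV in which the third strand passes over the singular crossing. -/
def RIVO : Set Move := {m4a, m4b, m4c, m4d}

/-- The moves of type IV in which the third strand passes under the singular crossing. -/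
def RIVU : Set Move := {m4e, m4f, m4g, m4h}

/-- The moves of type IV. -/
def RIV : Set Move := RIVO ∪ RIVU

/-- The moves of type V. -/
def RV : Set Move := {m5a, m5b, m5c, m5d, m5e, m5f}

/-- The ordinary Reidemeister moves. -/
def R : Set Move := RI ∪ RII ∪ RIII

/-- The Reidemeister moves that involve a singular crossing. -/
def SR : Set Move := RIV ∪ RV

/-! ## Generation and minimality -/

/-- Two diagrams in the same disk, with the same endpoints, are connected by a finite sequence of
planar isotopies and of moves from `S` (in either direction), each applied to a part of the diagram
in a smaller disk, with the rest of the diagram unchanged. -/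
inductive Connected (S : Set Move) : ∀ {u v : Word}, Diagram u v → Diagram u v → Prop
  | isotopy {u v : Word} {d e : Diagram u v} : ElementaryIsotopy d e → Connected S d e
  | move {m : Move} : m ∈ S → Connected S m.toLocalMove.before m.toLocalMove.after
  | addLeft {u v : Word} {d e : Diagram u v} (l : Word) :
      Connected S d e → Connected S (d.addLeft l) (e.addLeft l)
  | addRight {u v : Word} {d e : Diagram u v} (r : Word) :
      Connected S d e → Connected S (d.addRight r) (e.addRight r)
  | stack {u v w : Word} {d d' : Diagram u v} {e e' : Diagram v w} :
      Connected S d d' → Connected S e e' → Connected S (d.stack e) (d'.stack e')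
  | refl {u v : Word} (d : Diagram u v) : Connected S d d
  | symm {u v : Word} {d e : Diagram u v} : Connected S d e → Connected S e d
  | trans {u v : Word} {d e f : Diagram u v} :
      Connected S d e → Connected S e f → Connected S d f

/-- `m ≺ S`: the change made by `m` in its disk can be made by moves from `S` in that disk. -/
def GeneratedBy (m : Move) (S : Set Move) : Prop :=
  Connected S m.toLocalMove.before m.toLocalMove.after

/-- `S` is a generating set of the set of moves `T`. -/
def IsGeneratingSet (T S : Set Move) : Prop :=
  S ⊆ T ∧ ∀ m ∈ T, GeneratedBy m S

/-- `S` is a generating set of `T`, but no longer so when one of its elements is removed. -/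
def IsMinimalGeneratingSet (T S : Set Move) : Prop :=
  IsGeneratingSet T S ∧ ∀ m ∈ S, ¬ IsGeneratingSet T (S \ {m})

end SingularTangle

namespace SingularTangle

/-! ## Rewriting lists of layers -/

/-! Sufficiency is geometric. Given all moves of types I–III, a type IV move yields all those of its
family, by rotations and conjugation with type II moves, which keep over and under apart
(`Realizes.triangle_all`). One type V move yields all others by conjugation with the ordinary
crossing and by quarter turns; a quarter turn costs a curl and a passage both over and under a
singular crossing (`Realizes.flip_all`). These isotopies are written as explicit lists of rewriting
steps on layers and checked by computation.

Necessity uses invariants: the boundary colours and total weights of all colourings of a diagram.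
With two constant colours, the number modulo two of singular crossings of one sign between them
changes only under type V, where the two strands exchange sides at the singular crossing. For type
IV, strands are labelled `none` or by numbers modulo 3, and a number jumps on passing under a `none`
strand. When a `none` strand moves over a singular crossing, both numbers there shift equally, so
their sum changes by 2 up to sign. Type V forces the jump `s` at a singular crossing with a `none`
strand to satisfy `s = 1 - s`, whence one half. The mirror image detects passages under.

Finally, moves and isotopies neither create a first singular crossing nor remove a last one, so
ordinary moves are derived from ordinary moves only (`Connected.ordinary`). What remains is formal.
-/

theorem Stacks.unique {u v w : Word} {D : List Layer} (h : Stacks u D v) (h' : Stacks u D w) :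
    v = w := by
  induction D generalizing u with
  | nil => exact h.symm.trans h'
  | cons L D ih => exact ih h.2 h'.2

theorem Stacks.split {u v : Word} {D E : List Layer} (h : Stacks u (D ++ E) v) :
    ∃ w, Stacks u D w ∧ Stacks w E v := by
  induction D generalizing u with
  | nil => exact ⟨u, rfl, h⟩
  | cons L D ih =>
    obtain ⟨w, h₁, h₂⟩ := ih h.2
    exact ⟨w, ⟨h.1, h₁⟩, h₂⟩

/-- Put vertical strands on both sides of a layer. -/
def Layer.pad (l r : Word) (L : Layer) : Layer := ⟨l ++ L.left, L.piece, L.right ++ r⟩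

/-- Two lists of layers from `u` to `v` form diagrams that are connected by moves from `S`. -/
def Related (S : Set Move) (u v : Word) (D E : List Layer) : Prop :=
  ∃ (hD : Stacks u D v) (hE : Stacks u E v), Connected S (⟨D, hD⟩ : Diagram u v) ⟨E, hE⟩

namespace Related

variable {S : Set Move} {u v w : Word} {D D' E E' F : List Layer}

theorem of_connected {d e : Diagram u v} (h : Connected S d e) :
    Related S u v d.layers e.layers := ⟨d.valid, e.valid, h⟩

theorem refl (h : Stacks u D v) : Related S u v D D := ⟨h, h, .refl _⟩

theorem symm (h : Related S u v D E) : Related S u v E D := by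
  obtain ⟨hD, hE, h⟩ := h
  exact ⟨hE, hD, h.symm⟩

theorem trans (h : Related S u v D E) (h' : Related S u v E F) : Related S u v D F := by
  obtain ⟨hD, hE, h⟩ := h
  obtain ⟨hE', hF, h'⟩ := h'
  exact ⟨hD, hF, h.trans h'⟩

theorem append (h : Related S u v D D') (h' : Related S v w E E') :
    Related S u w (D ++ E) (D' ++ E') := by
  obtain ⟨hD, hE, h⟩ := h
  obtain ⟨hE', hF, h'⟩ := h'
  exact ⟨hD.append hE', hE.append hF, h.stack h'⟩

theorem pad (l r : Word) (h : Related S u v D E) :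
    Related S (l ++ (u ++ r)) (l ++ (v ++ r)) (D.map (Layer.pad l r)) (E.map (Layer.pad l r)) := by
  obtain ⟨hD, hE, h⟩ := h
  have := of_connected ((h.addRight r).addLeft l)
  rw [show Layer.pad l r = fun L => ⟨l ++ L.left, L.piece, L.right ++ r⟩ from rfl]
  simpa [Diagram.addLeft, Diagram.addRight, Function.comp_def] using this

end Related

/-- A pair of lists of layers which may replace each other. -/
structure Rule (S : Set Move) where
  bot : Word
  top : Word
  lhs : List Layer
  rhs : List Layer
  related : Related S bot top lhs rhs

/-- The rule read backwards. -/
def Rule.symm {S : Set Move} (R : Rule S) : Rule S := ⟨R.bot, R.top, R.rhs, R.lhs, R.related.symm⟩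

/-- The word met by a horizontal line above the first `n` layers. -/
def wordAt : Word → List Layer → ℕ → Word
  | u, _, 0 => u
  | u, [], _ + 1 => u
  | _, L :: D, n + 1 => wordAt L.cod D n

theorem Stacks.take {u v : Word} {D : List Layer} (h : Stacks u D v) (n : ℕ) :
    Stacks u (D.take n) (wordAt u D n) := by
  induction D generalizing u n with
  | nil => cases n <;> exact rfl
  | cons L D ih =>
    cases n with
    | zero => exact rfl
    | succ n => exact ⟨h.1, ih h.2 n⟩

/-- Steps of a derivation: the application of a rule above the first `i` layers and to the right of
the first `j` strands, and the exchange of the heights of two consecutive layers, the first of which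
is to the left (`swapL`) or to the right (`swapR`) of the second. -/
inductive Step (S : Set Move)
  | apply (R : Rule S) (i j : ℕ)
  | swapL (i : ℕ)
  | swapR (i : ℕ)

/-- The first layer after `swapL`. -/
def swapLFst (L K : Layer) : Layer :=
  ⟨L.left ++ (L.piece.dom ++ K.left.drop (L.left.length + L.piece.cod.length)), K.piece, K.right⟩

/-- The second layer after `swapL`. -/
def swapLSnd (L K : Layer) : Layer :=
  ⟨L.left, L.piece, K.left.drop (L.left.length + L.piece.cod.length) ++ (K.piece.cod ++ K.right)⟩

/-- The first layer after `swapR`. -/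
def swapRFst (L K : Layer) : Layer :=
  ⟨K.left, K.piece, L.left.drop (K.left.length + K.piece.dom.length) ++ (L.piece.dom ++ L.right)⟩

/-- The second layer after `swapR`. -/
def swapRSnd (L K : Layer) : Layer :=
  ⟨K.left ++ (K.piece.cod ++ L.left.drop (K.left.length + K.piece.dom.length)), L.piece, L.right⟩

variable {S : Set Move}

/-- The list of layers after a step. -/
def Step.next (u : Word) (D : List Layer) : Step S → List Layer
  | .apply R i j =>
    D.take i ++ (R.rhs.map (Layer.pad ((wordAt u D i).take j)
      ((wordAt u D i).drop (j + R.bot.length))) ++ D.drop (i + R.lhs.length))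
  | .swapL i => match D.drop i with
    | L :: K :: Q => D.take i ++ (swapLFst L K :: swapLSnd L K :: Q)
    | _ => D
  | .swapR i => match D.drop i with
    | L :: K :: Q => D.take i ++ (swapRFst L K :: swapRSnd L K :: Q)
    | _ => D

/-- The condition under which a step is possible. -/
def Step.Applies (u : Word) (D : List Layer) : Step S → Prop
  | .apply R i j =>
    wordAt u D i = (wordAt u D i).take j ++ (R.bot ++ (wordAt u D i).drop (j + R.bot.length)) ∧
    D.drop i = R.lhs.map (Layer.pad ((wordAt u D i).take j)
      ((wordAt u D i).drop (j + R.bot.length))) ++ D.drop (i + R.lhs.length)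
  | .swapL i => match D.drop i with
    | L :: K :: _ =>
      let w := K.left.drop (L.left.length + L.piece.cod.length)
      K.left = L.left ++ (L.piece.cod ++ w) ∧ L.right = w ++ (K.piece.dom ++ K.right)
    -- With fewer than two layers left above height `i`, `Step.next` returns the list unchanged, so
    -- no condition is needed.
    | _ => True
  | .swapR i => match D.drop i with
    | L :: K :: _ =>
      let w := L.left.drop (K.left.length + K.piece.dom.length)
      L.left = K.left ++ (K.piece.dom ++ w) ∧ K.right = w ++ (L.piece.cod ++ L.right)
    | _ => True

theorem related_replace {u v l r w w' : Word} {P Q X Y : List Layer} (h : Related S w w' X Y)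
    (hP : Stacks u P (l ++ (w ++ r))) (hD : Stacks u (P ++ (X.map (Layer.pad l r) ++ Q)) v) :
    Related S u v (P ++ (X.map (Layer.pad l r) ++ Q)) (P ++ (Y.map (Layer.pad l r) ++ Q)) := by
  obtain ⟨t, h₁, h₂⟩ := hD.split
  obtain rfl := h₁.unique hP
  obtain ⟨t, h₃, h₄⟩ := h₂.split
  obtain rfl := (h.pad l r).1.unique h₃
  exact (Related.refl hP).append ((h.pad l r).append (Related.refl h₄))

theorem related_exchange (p q : Piece) (l w r : Word) :
    Related S (l ++ (p.dom ++ (w ++ (q.dom ++ r)))) (l ++ (p.cod ++ (w ++ (q.cod ++ r))))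
      [⟨l, p, w ++ (q.dom ++ r)⟩, ⟨l ++ (p.cod ++ w), q, r⟩]
      [⟨l ++ (p.dom ++ w), q, r⟩, ⟨l, p, w ++ (q.cod ++ r)⟩] := by
  have := (Related.of_connected (S := S) (.isotopy (ElementaryIsotopy.exchange
    -- The strands `w` between the two pieces are counted with the left diagram.
    (⟨[⟨[], p, w⟩], rfl, rfl⟩ : Diagram (p.dom ++ w) (p.cod ++ w))
    (⟨[⟨[], q, []⟩], by simp [Layer.dom], by simp [Layer.cod, Stacks]⟩ :
      Diagram q.dom q.cod)))).pad l r
  simpa [Diagram.stack, Diagram.addLeft, Diagram.addRight, Layer.pad] using this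

/-- Rewriting preserves validity, so validity of either side suffices; `swapL` supplies the first
and `swapR` the second. -/
theorem related_swap {u v : Word} {p q : Piece} {l w r : Word} {P Q : List Layer}
    (hD : Stacks u (P ++ (⟨l, p, w ++ (q.dom ++ r)⟩ :: ⟨l ++ (p.cod ++ w), q, r⟩ :: Q)) v ∨
      Stacks u (P ++ (⟨l ++ (p.dom ++ w), q, r⟩ :: ⟨l, p, w ++ (q.cod ++ r)⟩ :: Q)) v) :
    Related S u v (P ++ (⟨l, p, w ++ (q.dom ++ r)⟩ :: ⟨l ++ (p.cod ++ w), q, r⟩ :: Q))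
      (P ++ (⟨l ++ (p.dom ++ w), q, r⟩ :: ⟨l, p, w ++ (q.cod ++ r)⟩ :: Q)) := by
  have key := related_exchange (S := S) p q l w r
  have aux : ∀ {X Y : List Layer} {x y : Word}, Related S x y X Y → Stacks u (P ++ (X ++ Q)) v →
      (∀ s t, Stacks s X t → s = x) →
      Related S u v (P ++ (X ++ Q)) (P ++ (Y ++ Q)) := by
    intro X Y x y h hD hx
    obtain ⟨t, h₁, h₂⟩ := hD.split
    obtain ⟨s, h₃, h₄⟩ := h₂.split
    obtain rfl := hx _ _ h₃
    obtain rfl := h.1.unique h₃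
    exact (Related.refl h₁).append (h.append (Related.refl h₄))
  rcases hD with hD | hD
  · exact aux key hD fun s t h => h.1
  · exact (aux key.symm hD fun s t h => h.1.trans (by simp [Layer.dom])).symm

theorem Step.Applies.related {u v : Word} {D : List Layer} {s : Step S} (h : s.Applies u D)
    (hD : Stacks u D v) : Related S u v D (s.next u D) := by
  cases s with
  | apply R i j =>
    obtain ⟨h₁, h₂⟩ := h
    have hP := hD.take i
    rw [h₁] at hP
    have hD' := hD
    rw [← List.take_append_drop i D, h₂] at hD'
    have := related_replace R.related hP hD'
    rwa [← h₂, List.take_append_drop] at this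
  | swapL i =>
    rw [← List.take_append_drop i D] at hD
    nth_rw 1 [← List.take_append_drop i D]
    simp only [Step.Applies, Step.next] at h ⊢
    split
    · rename_i L K Q hi
      obtain ⟨l, p, r⟩ := L
      obtain ⟨l', q, r'⟩ := K
      simp only [hi, swapLFst, swapLSnd] at h hD ⊢
      obtain ⟨h₁, h₂⟩ := h
      -- The `drop` only computes the word between the two pieces; once it is a variable, the
      -- condition puts both layers in the shape of `related_swap`.
      generalize List.drop _ _ = w at h₁ h₂ ⊢
      subst h₁ h₂
      exact related_swap (.inl hD)
    · rw [List.take_append_drop] at hD ⊢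
      exact Related.refl hD
  | swapR i =>
    rw [← List.take_append_drop i D] at hD
    nth_rw 1 [← List.take_append_drop i D]
    simp only [Step.Applies, Step.next] at h ⊢
    split
    · rename_i L K Q hi
      obtain ⟨l, p, r⟩ := L
      obtain ⟨l', q, r'⟩ := K
      simp only [hi, swapRFst, swapRSnd] at h hD ⊢
      obtain ⟨h₁, h₂⟩ := h
      generalize List.drop _ _ = w at h₁ h₂ ⊢
      subst h₁ h₂
      exact (related_swap (.inr hD)).symm
    · rw [List.take_append_drop] at hD ⊢
      exact Related.refl hD

/-- The steps lead from `D` to `E`. -/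
def Derives (u : Word) : List (Step S) → List Layer → List Layer → Prop
  | [], D, E => D = E
  | s :: ss, D, E => s.Applies u D ∧ Derives u ss (s.next u D) E

theorem Derives.related {u v : Word} {ss : List (Step S)} {D E : List Layer}
    (h : Derives u ss D E) (hD : Stacks u D v) : Related S u v D E := by
  induction ss generalizing D with
  | nil => cases h; exact Related.refl hD
  | cons s ss ih => exact (h.1.related hD).trans (ih h.2 (h.1.related hD).2.1)

/-! ## Rules coming from planar isotopies and moves -/

/-- The two diagrams of `m` are connected by moves from `S`. -/
def Realizes (S : Set Move) (m : LocalMove) : Prop := Connected S m.before m.after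

/-- The rule given by a realized move. -/
def Realizes.rule {m : LocalMove} (h : Realizes S m) : Rule S :=
  ⟨m.bot, m.top, m.before.layers, m.after.layers, .of_connected h⟩

/-- Reduces an isotopy to a finite check: the steps are listed explicitly and `simp` runs them. -/
theorem Realizes.of_derives {m : LocalMove} (ss : List (Step S))
    (h : Derives m.bot ss m.before.layers m.after.layers) : Realizes S m := by
  obtain ⟨_, _, h⟩ := h.related m.before.valid
  exact h

def zigzagRight (a : Bool) : Rule S :=
  ⟨[a], [a], [⟨[a], .cup (!a), []⟩, ⟨[], .cap a, [a]⟩], [],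
    .of_connected (.isotopy (.cancelRight a))⟩

def zigzagLeft (a : Bool) : Rule S :=
  ⟨[a], [a], [⟨[], .cup a, [a]⟩, ⟨[a], .cap (!a), []⟩], [],
    .of_connected (.isotopy (.cancelLeft a))⟩

def throughCap (k : Kind) (a b : Bool) : Rule S :=
  ⟨[a, b, !a], [b], [⟨[], .cross k a b, [!a]⟩, ⟨[b], .cap a, []⟩],
    [⟨[a], .cross k.turn b (!a), []⟩, ⟨[], .cap a, [b]⟩],
    .of_connected (.isotopy (.throughCap k a b))⟩

def throughCup (k : Kind) (a b : Bool) : Rule S :=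
  ⟨[b], [a, b, !a], [⟨[b], .cup a, []⟩, ⟨[], .cross k b a, [!a]⟩],
    [⟨[], .cup a, [b]⟩, ⟨[a], .cross k.turn (!a) b, []⟩],
    .of_connected (.isotopy (.throughCup k a b))⟩

@[simp]
theorem Kind.turn_turn (k : Kind) : k.turn.turn = k := by cases k <;> rfl

@[simp]
theorem Kind.turn_singular : Kind.singular.turn = .singular := rfl

/-- For a variable `k`, `throughCap k.turn` produces `k.turn.turn`, which does not match `k`
syntactically; here the turn is moved to the other side. -/
def throughCapTurn (k : Kind) (a b : Bool) : Rule S :=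
  ⟨[a, b, !a], [b], [⟨[], .cross k.turn a b, [!a]⟩, ⟨[b], .cap a, []⟩],
    [⟨[a], .cross k b (!a), []⟩, ⟨[], .cap a, [b]⟩],
    by simpa [throughCap] using (throughCap (S := S) k.turn a b).related⟩

def throughCupTurn (k : Kind) (a b : Bool) : Rule S :=
  ⟨[b], [a, b, !a], [⟨[b], .cup a, []⟩, ⟨[], .cross k.turn b a, [!a]⟩],
    [⟨[], .cup a, [b]⟩, ⟨[a], .cross k (!a) b, []⟩],
    by simpa [throughCup] using (throughCup (S := S) k.turn a b).related⟩

/-! ## Rotations of moves -/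

section

attribute [local simp] Derives Step.Applies Step.next swapLFst swapLSnd swapRFst swapRSnd wordAt
  Layer.pad Layer.cod Piece.dom Piece.cod Rule.symm Realizes.rule zigzagLeft zigzagRight throughCap
  throughCapTurn throughCup throughCupTurn curlRight curlLeft bigon triangle flip Diagram.vertical

/-- Half a turn of a move of type II. -/
theorem Realizes.bigon_rotate {a b : Bool} {k : Kind} (h : Realizes S (bigon a b k)) :
    Realizes S (bigon (!b) (!a) k.turn) := by
  -- Both strands are bent into zigzags and the two crossings are carried through the minima to the
  -- reversed legs. There the bigon appears after half a turn, `h` removes it, and the zigzags are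
  -- straightened.
  refine .of_derives [.apply (zigzagRight (!b)).symm 0 0, .swapL 1, .swapL 2,
    .apply (throughCup k b (!a)).symm 0 1, .apply (zigzagRight (!a)).symm 1 1, .swapL 2, .swapL 3,
    .apply (throughCupTurn k a b).symm 1 2, .swapL 2, .apply (throughCupTurn k a (!b)).symm 1 3,
    .swapL 0, .apply (throughCup k b a).symm 1 2, .apply h.rule 2 2,
    .swapR 1, .apply (zigzagRight (!a)) 0 1, .apply (zigzagRight (!b)) 0 0] ?_
  cases a <;> cases b <;> simp

/-- A sixth of a turn of a move of type III or IV. -/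
theorem Realizes.triangle_rotate {a b c : Bool} {p q r : Kind}
    (h : Realizes S (triangle a b c p q r)) :
    Realizes S (triangle b c (!a) r p.turn q.turn) := by
  -- The third strand is bent so that its reversed leg, of orientation `a`, serves as the first
  -- strand of `h`. A sixth of a turn exchanges the two sides of the move, so `h` is used backwards.
  refine .of_derives [.apply (zigzagLeft (!a)).symm 1 2, .swapR 2, .swapR 3,
    .apply (throughCupTurn p (!a) b) 1 1, .swapR 2, .apply (throughCupTurn q (!a) c) 1 0, .swapR 0,
    .apply h.rule.symm 1 1,
    .apply (throughCupTurn p (!a) b).symm 0 0, .swapL 1, .apply (throughCupTurn q (!a) c).symm 0 1,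
    .swapL 3, .swapL 2, .swapL 1, .apply (zigzagLeft (!a)) 0 2] ?_
  cases a <;> cases b <;> cases c <;> simp

/-- A curl on the left side of a strand of orientation `a`. -/
def leftCurl (a : Bool) (k : Kind) : LocalMove where
  bot := [a]
  top := [a]
  before := ⟨[⟨[], .cup (!a), [a]⟩, ⟨[!a], .cross k a a, []⟩, ⟨[], .cap (!a), [a]⟩],
    by cases a <;> exact ⟨rfl, rfl, rfl, rfl⟩⟩
  after := Diagram.vertical _

/-- Half a turn carries a curl on the right of an upward strand to one on the left of a downward
strand and keeps the kind of its crossing. -/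
theorem Realizes.leftCurl_of_curls {k : Kind} (hl : Realizes S (curlLeft k))
    (hr : Realizes S (curlRight k)) (a : Bool) : Realizes S (leftCurl a k) := by
  cases a
  · refine .of_derives [.apply (throughCupTurn k true false).symm 0 0,
      .apply (zigzagRight false).symm 1 0, .swapL 2, .swapL 3,
      .apply (throughCup k true true).symm 1 1, .apply hr.rule 1 1,
      .apply (zigzagRight false) 0 0] ?_
    simp [leftCurl]
  · exact hl

/-- If a strand on the left can pass a crossing of two others, so can a strand in the middle. -/
theorem Realizes.triangle_middle_of_first {a b c : Bool} {k q : Kind}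
    (h : Realizes S (triangle b a c k k q)) (h₁ : Realizes S (bigon a b k.turn))
    (h₂ : Realizes S (bigon b a k)) : Realizes S (triangle a b c k.turn q k) := by
  -- A bigon of the first two strands is created on top; after `h` is used backwards, the inverse
  -- bigon at the bottom cancels.
  refine .of_derives [.apply h₂.rule.symm 3 1, .apply h.rule.symm 1 0, .apply h₁.rule 0 0] ?_
  simp

/-- Conjugation: if `τ` is the singular crossing and `σ` the ordinary one, `τσ = στ` gives `τσ⁻¹ =
σ⁻¹τ`, the type II moves being `σσ⁻¹ = 1`. -/
theorem Realizes.flip_inv {a b : Bool} {k : Kind} (h : Realizes S (flip a b k))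
    (h₁ : Realizes S (bigon b a k.turn)) (h₂ : Realizes S (bigon b a k)) :
    Realizes S (flip b a k.turn) := by
  refine .of_derives [.apply h₁.rule.symm 0 0, .apply h.rule.symm 1 0, .apply h₂.rule 2 0] ?_
  simp

/-- A quarter of a turn of a move of type V. -/
theorem Realizes.flip_rotate {x y : Bool} {k : Kind} (hc : Realizes S (leftCurl y k))
    (ht : Realizes S (triangle y x y k k .singular))
    (ht' : Realizes S (triangle (!y) y x k.turn k.turn .singular))
    (h : Realizes S (flip x (!y) k.turn)) : Realizes S (flip x y k) := by
  -- A curl is inserted on the strand of orientation `y` between the two crossings. Sliding it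
  -- across the singular crossing by `ht` brings both crossings onto a leg of orientation `!y`,
  -- where `h` exchanges them; `ht'` then frees the curl, which is removed.
  refine .of_derives [.apply hc.rule.symm 1 0, .swapR 0, .swapL 3, .apply ht.rule.symm 1 1,
    .apply (throughCap .singular (!y) x).symm 3 0, .swapR 2,
    .apply (throughCupTurn k (!y) x).symm 0 0, .apply h.rule.symm 1 0,
    .apply (throughCup .singular (!y) x) 0 0, .apply (throughCapTurn k (!y) y).symm 3 1,
    .apply ht'.rule.symm 1 0,
    .swapL 3, .apply (throughCapTurn k (!y) x) 2 1, .swapL 1, .apply (throughCapTurn k (!y) y) 2 0,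
    .swapL 0, .apply hc.rule 1 0] ?_
  cases x <;> cases y <;> simp [leftCurl]

end

/-! ## Generation of the singular moves -/

/-- The eight choices of orientations and ordinary kind form four orbits under half turns,
represented by the four type II moves. -/
theorem realizes_bigon (hR : ∀ m ∈ R, GeneratedBy m S) (a b : Bool) {k : Kind}
    (hk : k ≠ .singular) : Realizes S (bigon a b k) := by
  have h₁ : Realizes S (bigon true true .rightOver) := hR .m2a (by simp [R, RII])
  have h₂ : Realizes S (bigon true true .leftOver) := hR .m2b (by simp [R, RII])
  have h₃ : Realizes S (bigon true false .rightOver) := hR .m2c (by simp [R, RII])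
  have h₄ : Realizes S (bigon false true .rightOver) := hR .m2d (by simp [R, RII])
  cases k
  · cases a <;> cases b
    exacts [h₂.bigon_rotate, h₄, h₃, h₁]
  · cases a <;> cases b
    exacts [h₁.bigon_rotate, h₄.bigon_rotate, h₃.bigon_rotate, h₂]
  · exact absurd rfl hk

theorem realizes_leftCurl (hR : ∀ m ∈ R, GeneratedBy m S) (a : Bool) {k : Kind}
    (hk : k ≠ .singular) : Realizes S (leftCurl a k) := by
  cases k
  · exact .leftCurl_of_curls (hR .m1a (by simp [R, RI])) (hR .m1b (by simp [R, RI])) a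
  · exact .leftCurl_of_curls (hR .m1c (by simp [R, RI])) (hR .m1d (by simp [R, RI])) a
  · exact absurd rfl hk

theorem Kind.turn_ne_singular {k : Kind} (hk : k ≠ .singular) : k.turn ≠ .singular := by
  cases k
  exacts [nofun, nofun, hk]

/-- A strand passing over (or under) a singular crossing can do so for all orientations, if it can
for one choice of orientations. -/
theorem Realizes.triangle_all (hR : ∀ m ∈ R, GeneratedBy m S) {k : Kind} (hk : k ≠ .singular)
    {a b c : Bool} (h : Realizes S (triangle a b c k.turn .singular k)) (a' b' c' : Bool) :
    Realizes S (triangle a' b' c' k.turn .singular k) := by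
  -- A sixth of a turn puts the moving strand first, and the type II moves bring it back to the
  -- middle. The effect `(a, c) ↦ (c, !a)` has order four and reaches all orientations of the
  -- crossing strands.
  have quarter : ∀ {a b c : Bool}, Realizes S (triangle a b c k.turn .singular k) →
      Realizes S (triangle c b (!a) k.turn .singular k) := by
    intro a b c h
    have h' := h.triangle_rotate
    rw [Kind.turn_turn, Kind.turn_singular] at h'
    exact h'.triangle_middle_of_first (realizes_bigon hR _ _ (Kind.turn_ne_singular hk))
      (realizes_bigon hR _ _ hk)
  -- Three sixths of a turn reverse everything, including `b`, which `quarter` fixes.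
  have half : ∀ {a b c : Bool}, Realizes S (triangle a b c k.turn .singular k) →
      Realizes S (triangle (!a) (!b) (!c) k.turn .singular k) := by
    intro a b c h
    have h' := h.triangle_rotate.triangle_rotate.triangle_rotate
    simpa using h'
  have any : ∀ a' c', Realizes S (triangle a' b c' k.turn .singular k) := by
    have h₁ := quarter h
    have h₂ := quarter h₁
    have h₃ := quarter h₂
    intro a' c'
    cases a <;> cases c <;> cases a' <;> cases c' <;> assumption
  rcases Bool.eq_or_eq_not b' b with rfl | rfl
  · exact any a' c'
  · simpa using half (any (!a') (!c'))

/-- Brings type IV moves into the form that `Realizes.flip_rotate` consumes. -/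
theorem Realizes.triangle_first (hR : ∀ m ∈ R, GeneratedBy m S) {k : Kind} (hk : k ≠ .singular)
    {a b c : Bool} (h : Realizes S (triangle a b c k.turn .singular k)) (a' b' c' : Bool) :
    Realizes S (triangle a' b' c' k k .singular) := by
  simpa using (h.triangle_all hR hk (!c') a' b').triangle_rotate

/-- A singular and an ordinary crossing can be exchanged for all orientations and kinds, if they can
for one choice of these. -/
theorem Realizes.flip_all (hR : ∀ m ∈ R, GeneratedBy m S)
    (ht : ∀ a b c k, k ≠ .singular → Realizes S (triangle a b c k k .singular))
    {a b : Bool} {k : Kind} (hk : k ≠ .singular) (h : Realizes S (flip a b k))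
    (a' b' : Bool) {k' : Kind} (hk' : k' ≠ .singular) : Realizes S (flip a' b' k') := by
  have inv : ∀ {a b k}, k ≠ .singular → Realizes S (flip a b k) → Realizes S (flip b a k.turn) :=
    fun hk h => h.flip_inv (realizes_bigon hR _ _ (Kind.turn_ne_singular hk))
      (realizes_bigon hR _ _ hk)
  have rot : ∀ {a b k}, k ≠ .singular → Realizes S (flip a b k) →
      Realizes S (flip a (!b) k.turn) := fun hk h =>
    .flip_rotate (realizes_leftCurl hR _ (Kind.turn_ne_singular hk))
      (ht _ _ _ _ (Kind.turn_ne_singular hk)) (ht _ _ _ _ (by simpa)) (by simpa)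
  -- `(a, b) ↦ (!b, a)` runs through all four pairs of orientations with the kind fixed; `inv` then
  -- gives the opposite kind.
  have step : ∀ {a b k}, k ≠ .singular → Realizes S (flip a b k) → Realizes S (flip (!b) a k) :=
    fun hk h => by simpa using inv (Kind.turn_ne_singular hk) (rot hk h)
  have h₁ := step hk h
  have h₂ := step hk h₁
  have h₃ := step hk h₂
  have g₀ := inv hk h
  have g₁ := inv hk h₁
  have g₂ := inv hk h₂
  have g₃ := inv hk h₃
  cases k <;> cases k' <;> first
    | exact absurd rfl hk
    | exact absurd rfl hk'
    | (cases a <;> cases b <;> cases a' <;> cases b' <;> assumption)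

/-! ## Weighted colourings -/

/-- A rule for colouring the edges of a diagram by `C` and weighting its crossings by `G`: the
colours at the bottom of a crossing determine those at the top and the weight. -/
structure Coloring (C G : Type) where
  cross : Kind → Bool → Bool → C → C → C × C
  weight : Kind → Bool → Bool → C → C → G

namespace Coloring

variable {C G : Type} [AddCommMonoid G] (M : Coloring C G)

/-- The bottom colours `x` and top colours `y` of an elementary piece with further vertical strands
on its right, coloured with weight `g`. -/
def PieceEval : Piece → List C → List C → G → Prop
  | .cup _, x, y, g => ∃ c, y = c :: c :: x ∧ g = 0
  | .cap _, x, y, g => ∃ c, x = c :: c :: y ∧ g = 0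
  | .cross k a b, x, y, g => ∃ c d t, x = c :: d :: t ∧
      y = (M.cross k a b c d).1 :: (M.cross k a b c d).2 :: t ∧ g = M.weight k a b c d

/-- The same with vertical strands on the left. -/
def LayerEval : Word → Piece → List C → List C → G → Prop
  | [], p, x, y, g => M.PieceEval p x y g
  | _ :: l, p, x, y, g => ∃ c x' y', x = c :: x' ∧ y = c :: y' ∧ LayerEval l p x' y' g

/-- A list of layers has a colouring of weight `g` with bottom colours `x` and top colours `z`. -/
def Eval : List Layer → List C → List C → G → Prop
  | [], x, z, g => z = x ∧ g = 0
  | L :: D, x, z, g => ∃ y g₁ g₂, M.LayerEval L.left L.piece x y g₁ ∧ Eval D y z g₂ ∧ g = g₁ + g₂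

variable {M}

theorem LayerEval.length {l : Word} {p : Piece} {x y : List C} {g : G}
    (h : M.LayerEval l p x y g) : x.length + p.cod.length = y.length + p.dom.length := by
  induction l generalizing x y with
  | nil =>
    cases p with
    | cup a => obtain ⟨c, rfl, -⟩ := h; simp [Piece.dom, Piece.cod]
    | cap a => obtain ⟨c, rfl, -⟩ := h; simp [Piece.dom, Piece.cod]
    | cross k a b => obtain ⟨c, d, t, rfl, rfl, -⟩ := h; simp [Piece.dom, Piece.cod]
  | cons _ l ih =>
    obtain ⟨c, x, y, rfl, rfl, h⟩ := h
    have := ih h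
    simp only [List.length_cons]
    omega

theorem Eval.length {u v : Word} {D : List Layer} {x z : List C} {g : G} (h : M.Eval D x z g)
    (hD : Stacks u D v) (hx : x.length = u.length) : z.length = v.length := by
  induction D generalizing u x g with
  | nil => cases hD; rw [h.1, hx]
  | cons L D ih =>
    obtain ⟨y, g₁, g₂, h₁, h₂, -⟩ := h
    refine ih h₂ hD.2 ?_
    have := h₁.length
    rw [hD.1] at hx
    simp only [Layer.dom, Layer.cod, List.length_append] at hx ⊢
    omega

/-! ### Colourings of stacked and juxtaposed diagrams -/

theorem eval_append {D E : List Layer} {x z : List C} {g : G} :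
    M.Eval (D ++ E) x z g ↔ ∃ y g₁ g₂, M.Eval D x y g₁ ∧ M.Eval E y z g₂ ∧ g = g₁ + g₂ := by
  induction D generalizing x g with
  | nil => simp [Eval]
  | cons L D ih =>
    simp only [List.cons_append, Eval, ih]
    constructor
    · rintro ⟨y, g₁, _, h₁, ⟨y', g₂, g₃, h₂, h₃, rfl⟩, rfl⟩
      exact ⟨y', _, g₃, ⟨y, g₁, g₂, h₁, h₂, rfl⟩, h₃, (add_assoc _ _ _).symm⟩
    · rintro ⟨y', _, g₃, ⟨y, g₁, g₂, h₁, h₂, rfl⟩, h₃, rfl⟩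
      exact ⟨y, g₁, _, h₁, ⟨y', g₂, g₃, h₂, h₃, rfl⟩, add_assoc _ _ _⟩

theorem layerEval_left {l l' : Word} {p : Piece} {s x y : List C} {g : G}
    (hs : s.length = l.length) : M.LayerEval (l ++ l') p (s ++ x) y g ↔
      ∃ y', y = s ++ y' ∧ M.LayerEval l' p x y' g := by
  induction l generalizing s y with
  | nil =>
    obtain rfl := List.length_eq_zero_iff.1 hs
    simp
  | cons a l ih =>
    obtain ⟨c, s, rfl⟩ := List.exists_cons_of_length_eq_add_one hs
    simp only [List.length_cons, Nat.add_right_cancel_iff] at hs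
    simp only [List.cons_append, LayerEval, List.cons.injEq]
    constructor
    · rintro ⟨c', x', y', ⟨rfl, rfl⟩, rfl, h⟩
      obtain ⟨y', rfl, h'⟩ := (ih hs).1 h
      exact ⟨y', rfl, h'⟩
    · rintro ⟨y', rfl, h⟩
      exact ⟨c, _, _, ⟨rfl, rfl⟩, rfl, (ih hs).2 ⟨y', rfl, h⟩⟩

theorem layerEval_right {l : Word} {p : Piece} {t x y : List C} {g : G}
    (hx : l.length + p.dom.length ≤ x.length) : M.LayerEval l p (x ++ t) y g ↔
      ∃ y', y = y' ++ t ∧ M.LayerEval l p x y' g := by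
  induction l generalizing x y with
  | nil =>
    cases p with
    | cup a =>
      constructor
      · rintro ⟨c, rfl, rfl⟩
        exact ⟨c :: c :: x, rfl, c, rfl, rfl⟩
      · rintro ⟨_, rfl, c, rfl, rfl⟩
        exact ⟨c, rfl, rfl⟩
    | cap a =>
      match x with
      | [] | [_] => simp [Piece.dom] at hx
      | c :: d :: x =>
        constructor
        · rintro ⟨c', h, rfl⟩
          simp only [List.cons_append, List.cons.injEq] at h
          obtain ⟨rfl, rfl, rfl⟩ := h
          exact ⟨x, rfl, _, rfl, rfl⟩
        · rintro ⟨y', rfl, c', h, rfl⟩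
          simp only [List.cons.injEq] at h
          obtain ⟨rfl, rfl, rfl⟩ := h
          exact ⟨_, rfl, rfl⟩
    | cross k a b =>
      match x with
      | [] | [_] => simp [Piece.dom] at hx
      | c :: d :: x =>
        constructor
        · rintro ⟨c', d', t', h, rfl, rfl⟩
          simp only [List.cons_append, List.cons.injEq] at h
          obtain ⟨rfl, rfl, rfl⟩ := h
          exact ⟨_, rfl, _, _, _, rfl, rfl, rfl⟩
        · rintro ⟨y', rfl, c', d', t', h, rfl, rfl⟩
          simp only [List.cons.injEq] at h
          obtain ⟨rfl, rfl, rfl⟩ := h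
          exact ⟨_, _, _, rfl, rfl, rfl⟩
  | cons a l ih =>
    match x with
    | [] => simp at hx
    | c :: x =>
      have hx' : l.length + p.dom.length ≤ x.length := by
        simp only [List.length_cons] at hx
        omega
      simp only [List.cons_append, LayerEval, List.cons.injEq]
      constructor
      · rintro ⟨c', x', y', ⟨rfl, rfl⟩, rfl, h⟩
        obtain ⟨y', rfl, h'⟩ := (ih hx').1 h
        exact ⟨_ :: y', rfl, _, _, _, ⟨rfl, rfl⟩, rfl, h'⟩
      · rintro ⟨_, rfl, c', x', y', ⟨rfl, rfl⟩, rfl, h⟩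
        exact ⟨_, _, _, ⟨rfl, rfl⟩, rfl, (ih hx').2 ⟨y', rfl, h⟩⟩

theorem eval_left {l : Word} {D : List Layer} {s x z : List C} {g : G}
    (hs : s.length = l.length) :
    M.Eval (D.map fun L => ⟨l ++ L.left, L.piece, L.right⟩) (s ++ x) z g ↔
      ∃ z', z = s ++ z' ∧ M.Eval D x z' g := by
  induction D generalizing x g with
  | nil =>
    constructor
    · rintro ⟨rfl, rfl⟩
      exact ⟨x, rfl, rfl, rfl⟩
    · rintro ⟨_, rfl, rfl, rfl⟩
      exact ⟨rfl, rfl⟩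
  | cons L D ih =>
    simp only [List.map_cons, Eval, layerEval_left hs]
    constructor
    · rintro ⟨_, g₁, g₂, ⟨y, rfl, h₁⟩, h₂, rfl⟩
      obtain ⟨z', rfl, h₃⟩ := ih.1 h₂
      exact ⟨z', rfl, y, g₁, g₂, h₁, h₃, rfl⟩
    · rintro ⟨z', rfl, y, g₁, g₂, h₁, h₂, rfl⟩
      exact ⟨_, g₁, g₂, ⟨y, rfl, h₁⟩, ih.2 ⟨z', rfl, h₂⟩, rfl⟩

/-- Evaluation ignores the words to the right of a piece, so the lengths must ensure that no piece
reaches into the colours `t`. -/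
theorem eval_right {u v r : Word} {D : List Layer} {t x z : List C} {g : G} (hD : Stacks u D v)
    (hx : x.length = u.length) :
    M.Eval (D.map fun L => ⟨L.left, L.piece, L.right ++ r⟩) (x ++ t) z g ↔
      ∃ z', z = z' ++ t ∧ M.Eval D x z' g := by
  induction D generalizing u x g with
  | nil =>
    constructor
    · rintro ⟨rfl, rfl⟩
      exact ⟨x, rfl, rfl, rfl⟩
    · rintro ⟨_, rfl, rfl, rfl⟩
      exact ⟨rfl, rfl⟩
  | cons L D ih =>
    have hx' : L.left.length + L.piece.dom.length ≤ x.length := by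
      rw [hx, hD.1]
      simp only [Layer.dom, List.length_append]
      omega
    have hy : ∀ {y g₁}, M.LayerEval L.left L.piece x y g₁ → y.length = L.cod.length := by
      intro y g₁ h
      have := h.length
      rw [hD.1] at hx
      simp only [Layer.dom, Layer.cod, List.length_append] at hx ⊢
      omega
    simp only [List.map_cons, Eval, layerEval_right hx']
    constructor
    · rintro ⟨_, g₁, g₂, ⟨y, rfl, h₁⟩, h₂, rfl⟩
      obtain ⟨z', rfl, h₃⟩ := (ih hD.2 (hy h₁)).1 h₂
      exact ⟨z', rfl, y, g₁, g₂, h₁, h₃, rfl⟩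
    · rintro ⟨z', rfl, y, g₁, g₂, h₁, h₂, rfl⟩
      exact ⟨_, g₁, g₂, ⟨y, rfl, h₁⟩, (ih hD.2 (hy h₁)).2 ⟨z', rfl, h₂⟩, rfl⟩

/-! ### Invariance of weighted colourings -/

variable (M)

/-- Two diagrams have the same weighted colourings. -/
def Same {u v : Word} (d e : Diagram u v) : Prop :=
  ∀ (x z : List C) (g : G), x.length = u.length → (M.Eval d.layers x z g ↔ M.Eval e.layers x z g)

/-- The weighted colourings are preserved when a crossing passes through a local maximum or
minimum. -/
structure IsotopyInvariant : Prop where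
  cap_left : ∀ k a b x y z, (M.cross k a b x y).2 = z →
    M.cross k.turn b (!a) y z = (x, (M.cross k a b x y).1) ∧
      M.weight k.turn b (!a) y z = M.weight k a b x y
  cap_right : ∀ k a b x y z, (M.cross k.turn b (!a) y z).1 = x →
    M.cross k a b x y = ((M.cross k.turn b (!a) y z).2, z) ∧
      M.weight k.turn b (!a) y z = M.weight k a b x y
  cup_left : ∀ k a b x y z, (M.cross k b a x y).1 = z →
    M.cross k.turn (!a) b z x = ((M.cross k b a x y).2, y) ∧
      M.weight k.turn (!a) b z x = M.weight k b a x y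
  cup_right : ∀ k a b x y z, (M.cross k.turn (!a) b z x).2 = y →
    M.cross k b a x y = (z, (M.cross k.turn (!a) b z x).1) ∧
      M.weight k.turn (!a) b z x = M.weight k b a x y

variable {M}

/-- Exchanging heights reorders the weights, which is why they are taken in a commutative monoid. -/
theorem same_exchange {u v u' v' : Word} (d : Diagram u v) (e : Diagram u' v') :
    M.Same ((d.addRight u').stack (e.addLeft v)) ((e.addLeft u).stack (d.addRight v')) := by
  intro x z g hx
  obtain ⟨x, s, rfl, hx, hs⟩ : ∃ x' s, x = x' ++ s ∧ x'.length = u.length ∧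
      s.length = u'.length := by
    refine ⟨x.take u.length, x.drop u.length, by simp, ?_, ?_⟩ <;>
      simp [hx]
  simp only [Diagram.stack, Diagram.addLeft, Diagram.addRight, eval_append, eval_right d.valid hx,
    eval_left hx]
  constructor
  · rintro ⟨_, g₁, g₂, ⟨y, rfl, h₁⟩, h₂, rfl⟩
    obtain ⟨z, rfl, h₃⟩ := (eval_left (h₁.length d.valid hx)).1 h₂
    exact ⟨_, g₂, g₁, ⟨z, rfl, h₃⟩, (eval_right d.valid hx).2 ⟨y, rfl, h₁⟩, add_comm _ _⟩
  · rintro ⟨_, g₁, g₂, ⟨y, rfl, h₁⟩, h₂, rfl⟩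
    obtain ⟨z, rfl, h₃⟩ := (eval_right d.valid hx).1 h₂
    exact ⟨_, g₂, g₁, ⟨z, rfl, h₃⟩, (eval_left (h₃.length d.valid hx)).2 ⟨y, rfl, h₁⟩,
      add_comm _ _⟩

theorem IsotopyInvariant.same (hM : M.IsotopyInvariant) {u v : Word} {d e : Diagram u v}
    (h : ElementaryIsotopy d e) : M.Same d e := by
  cases h with
  | exchange d e => exact same_exchange d e
  | cancelRight a =>
    intro x z g hx
    obtain ⟨x, rfl⟩ := List.length_eq_one_iff.1 hx
    simp only [Eval, LayerEval, PieceEval, Diagram.vertical]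
    aesop
  | cancelLeft a =>
    intro x z g hx
    obtain ⟨x, rfl⟩ := List.length_eq_one_iff.1 hx
    simp only [Eval, LayerEval, PieceEval, Diagram.vertical]
    aesop
  | throughCap k a b =>
    intro x z g hx
    obtain ⟨x₁, x₂, x₃, rfl⟩ := List.length_eq_three.1 hx
    simp only [Eval, LayerEval, PieceEval, List.cons.injEq, exists_eq_left', exists_and_left,
      exists_eq_left, existsAndEq, true_and, and_true, add_zero]
    constructor
    · rintro ⟨⟨h, rfl⟩, rfl⟩
      obtain ⟨h₁, h₂⟩ := hM.cap_left k a b x₁ x₂ x₃ h.symm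
      simp [h₁, h₂]
    · rintro ⟨⟨h, rfl⟩, rfl⟩
      obtain ⟨h₁, h₂⟩ := hM.cap_right k a b x₁ x₂ x₃ h
      simp [h₁, h₂]
  | throughCup k a b =>
    intro x z g hx
    obtain ⟨x, rfl⟩ := List.length_eq_one_iff.1 hx
    simp only [Eval, LayerEval, PieceEval, List.cons.injEq, exists_eq_left', exists_and_left,
      existsAndEq, true_and, and_true, add_zero, zero_add]
    constructor
    · rintro ⟨y, rfl, rfl⟩
      obtain ⟨h₁, h₂⟩ := hM.cup_left k a b x y _ rfl
      exact ⟨_, by rw [h₁], h₂.symm⟩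
    · rintro ⟨y, rfl, rfl⟩
      obtain ⟨h₁, h₂⟩ := hM.cup_right k a b x _ y rfl
      exact ⟨_, by rw [h₁], h₂⟩

theorem IsotopyInvariant.same_of_connected (hM : M.IsotopyInvariant) {S : Set Move}
    (hS : ∀ m ∈ S, M.Same m.toLocalMove.before m.toLocalMove.after) {u v : Word}
    {d e : Diagram u v} (h : Connected S d e) : M.Same d e := by
  induction h with
  | isotopy h => exact hM.same h
  | move h => exact hS _ h
  | @addLeft u v d e l _ ih =>
    intro x z g hx
    obtain ⟨s, x, rfl, hs, hx⟩ : ∃ s x', x = s ++ x' ∧ s.length = l.length ∧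
        x'.length = u.length := by
      refine ⟨x.take l.length, x.drop l.length, by simp, ?_, ?_⟩ <;> simp [hx]
    simp only [Diagram.addLeft, eval_left hs]
    exact exists_congr fun z' => and_congr_right fun _ => ih _ _ _ hx
  | @addRight u v d e r _ ih =>
    intro x z g hx
    obtain ⟨x, t, rfl, hx, -⟩ : ∃ x' t, x = x' ++ t ∧ x'.length = u.length ∧
        t.length = r.length := by
      refine ⟨x.take u.length, x.drop u.length, by simp, ?_, ?_⟩ <;> simp [hx]
    simp only [Diagram.addRight, eval_right d.valid hx, eval_right e.valid hx]
    exact exists_congr fun z' => and_congr_right fun _ => ih _ _ _ hx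
  | @stack u v w d d' e e' _ _ ih ih' =>
    intro x z g hx
    simp only [Diagram.stack, eval_append]
    refine exists_congr fun y => exists_congr fun g₁ => exists_congr fun g₂ => ?_
    rw [ih _ _ _ hx]
    refine and_congr_right fun h => ?_
    rw [ih' _ _ _ (h.length d'.valid hx)]
  | refl => exact fun _ _ _ _ => .rfl
  | symm _ ih => exact fun x z g hx => (ih x z g hx).symm
  | trans _ _ ih ih' => exact fun x z g hx => (ih x z g hx).trans (ih' x z g hx)

/-! ### Local moves -/

/-- The minimum of the loop introduces a free colour `c`; the condition at the maximum has to force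
`c = x`, and the self-crossing must then contribute nothing. -/
theorem same_curlRight {k : Kind}
    (h : ∀ x c, c = (M.cross k true true x c).2 ↔ c = x)
    (h' : ∀ x, (M.cross k true true x x).1 = x ∧ M.weight k true true x x = 0) :
    M.Same (curlRight k).before (curlRight k).after := by
  intro x z g hx
  obtain ⟨x, rfl⟩ := List.length_eq_one_iff.1 hx
  simp [Eval, LayerEval, PieceEval, Diagram.vertical, curlRight, h, h', and_assoc]

theorem same_curlLeft {k : Kind}
    (h : ∀ x c, c = (M.cross k true true c x).1 ↔ c = x)
    (h' : ∀ x, (M.cross k true true x x).2 = x ∧ M.weight k true true x x = 0) :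
    M.Same (curlLeft k).before (curlLeft k).after := by
  intro x z g hx
  obtain ⟨x, rfl⟩ := List.length_eq_one_iff.1 hx
  simp [Eval, LayerEval, PieceEval, Diagram.vertical, curlLeft, h, h', and_assoc,
    eq_comm (b := z)]

variable (M)

/-- The top colours and the weight of two consecutive crossings of the same two strands. -/
def twoCrossings (a b : Bool) (k k' : Kind) (x y : C) : (C × C) × G :=
  let p := M.cross k a b x y
  (M.cross k' b a p.1 p.2, M.weight k a b x y + M.weight k' b a p.1 p.2)

/-- The top colours and the weight of the diagram before a move of type III or IV. -/
def triangleBefore (a b c : Bool) (p q r : Kind) (x y z : C) : (C × C × C) × G :=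
  let s := M.cross p a b x y
  let t := M.cross q a c s.2 z
  let u := M.cross r b c s.1 t.1
  ((u.1, u.2, t.2), M.weight p a b x y + (M.weight q a c s.2 z + M.weight r b c s.1 t.1))

/-- The top colours and the weight of the diagram after a move of type III or IV. -/
def triangleAfter (a b c : Bool) (p q r : Kind) (x y z : C) : (C × C × C) × G :=
  let s := M.cross r b c y z
  let t := M.cross q a c x s.1
  let u := M.cross p a b t.2 s.2
  ((t.1, u.1, u.2), M.weight r b c y z + (M.weight q a c x s.1 + M.weight p a b t.2 s.2))

variable {M}

theorem eval_twoCrossings {a b : Bool} {k k' : Kind} {x y : C} {z : List C} {g : G} :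
    M.Eval [⟨[], .cross k a b, []⟩, ⟨[], .cross k' b a, []⟩] [x, y] z g ↔
      z = [(M.twoCrossings a b k k' x y).1.1, (M.twoCrossings a b k k' x y).1.2] ∧
        g = (M.twoCrossings a b k k' x y).2 := by
  simp [Eval, LayerEval, PieceEval, twoCrossings]

theorem eval_triangle_before {a b c : Bool} {p q r : Kind} {x y z : C} {w : List C} {g : G} :
    M.Eval (triangle a b c p q r).before.layers [x, y, z] w g ↔
      w = [(M.triangleBefore a b c p q r x y z).1.1, (M.triangleBefore a b c p q r x y z).1.2.1,
        (M.triangleBefore a b c p q r x y z).1.2.2] ∧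
        g = (M.triangleBefore a b c p q r x y z).2 := by
  simp [Eval, LayerEval, PieceEval, triangle, triangleBefore]

theorem eval_triangle_after {a b c : Bool} {p q r : Kind} {x y z : C} {w : List C} {g : G} :
    M.Eval (triangle a b c p q r).after.layers [x, y, z] w g ↔
      w = [(M.triangleAfter a b c p q r x y z).1.1, (M.triangleAfter a b c p q r x y z).1.2.1,
        (M.triangleAfter a b c p q r x y z).1.2.2] ∧
        g = (M.triangleAfter a b c p q r x y z).2 := by
  simp [Eval, LayerEval, PieceEval, triangle, triangleAfter]

theorem same_bigon {a b : Bool} {k : Kind}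
    (h : ∀ x y, M.twoCrossings a b k k.turn x y = ((x, y), 0)) :
    M.Same (bigon a b k).before (bigon a b k).after := by
  intro x z g hx
  obtain ⟨x, y, rfl⟩ := List.length_eq_two.1 hx
  exact eval_twoCrossings.trans (by rw [h]; rfl)

theorem same_flip_iff {a b : Bool} {k : Kind} :
    M.Same (flip a b k).before (flip a b k).after ↔
      ∀ x y, M.twoCrossings a b .singular k x y = M.twoCrossings a b k .singular x y := by
  constructor
  · intro h x y
    have := (h [x, y] _ _ rfl).1 (eval_twoCrossings.2 ⟨rfl, rfl⟩)
    have := eval_twoCrossings.1 this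
    simpa [Prod.ext_iff] using this
  · intro h x z g hx
    obtain ⟨x, y, rfl⟩ := List.length_eq_two.1 hx
    exact eval_twoCrossings.trans (by rw [h]; exact eval_twoCrossings.symm)

theorem same_triangle_iff {a b c : Bool} {p q r : Kind} :
    M.Same (triangle a b c p q r).before (triangle a b c p q r).after ↔
      ∀ x y z, M.triangleBefore a b c p q r x y z = M.triangleAfter a b c p q r x y z := by
  constructor
  · intro h x y z
    have := (h [x, y, z] _ _ rfl).1 (eval_triangle_before.2 ⟨rfl, rfl⟩)
    have := eval_triangle_after.1 this
    simpa [Prod.ext_iff, and_assoc] using this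
  · intro h x z g hx
    obtain ⟨x₁, x₂, x₃, rfl⟩ := List.length_eq_three.1 hx
    rw [eval_triangle_before, eval_triangle_after, h]

end Coloring

/-! ### The colourings that detect the singular moves -/

/-- Crossings preserve the colours of the strands; a singular crossing is weighted by the
intersection number modulo two, if positive, of the strands of colours `true` and `false`. -/
def intersectionColoring : Coloring Bool (ZMod 2) where
  cross _ _ _ x y := (y, x)
  weight
    | .singular, a, b, x, y => if x ≠ y ∧ (x = true ↔ a = b) then 1 else 0
    | _, _, _, _, _ => 0

/-- The colour `none` is constant along strands; a strand of another colour gains or loses one,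
according to the sign, at each crossing under a strand of colour `none`, and half of it, which is the
opposite modulo three, at each singular crossing with such a strand. A singular crossing of two
strands with numbers is weighted by their sum. Crossings are turned first if `τ` holds. -/
def passageColoring (τ : Bool) : Coloring (Option (ZMod 3)) (ZMod 3) where
  cross k a b x y := match cond τ k.turn k with
    | .rightOver => (if x = none then y.map (· + cond a 1 (-1)) else y, x)
    | .leftOver => (y, if y = none then x.map (· - cond b 1 (-1)) else x)
    | .singular => (if x = none then y.map (· - cond a 1 (-1)) else y,
        if y = none then x.map (· + cond b 1 (-1)) else x)
  weight
    | .singular, _, _, some x, some y => x + y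
    | _, _, _, _, _ => 0

open Coloring

theorem isotopyInvariant_intersectionColoring : intersectionColoring.IsotopyInvariant := by
  constructor <;> intro k <;> cases k <;> decide

theorem isotopyInvariant_passageColoring (τ : Bool) : (passageColoring τ).IsotopyInvariant := by
  constructor <;> intro k <;> revert τ <;> cases k <;> decide

theorem same_intersectionColoring {m : Move} (hm : m ∉ RV) :
    intersectionColoring.Same m.toLocalMove.before m.toLocalMove.after := by
  cases m <;> first
    | (refine absurd ?_ hm; simp [RV]; done)
    | (refine same_triangle_iff.2 ?_; decide)
    | (refine same_bigon ?_; decide)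
    | (refine same_curlLeft ?_ ?_ <;> decide)
    | (refine same_curlRight ?_ ?_ <;> decide)

theorem same_passageColoring_false {m : Move} (hm : m ∉ RIVO) :
    (passageColoring false).Same m.toLocalMove.before m.toLocalMove.after := by
  cases m <;> first
    | (refine absurd ?_ hm; simp [RIVO]; done)
    | (refine same_triangle_iff.2 ?_; decide)
    | (refine same_bigon ?_; decide)
    | (refine same_flip_iff.2 ?_; decide)
    | (refine same_curlLeft ?_ ?_ <;> decide)
    | (refine same_curlRight ?_ ?_ <;> decide)

theorem same_passageColoring_true {m : Move} (hm : m ∉ RIVU) :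
    (passageColoring true).Same m.toLocalMove.before m.toLocalMove.after := by
  cases m <;> first
    | (refine absurd ?_ hm; simp [RIVU]; done)
    | (refine same_triangle_iff.2 ?_; decide)
    | (refine same_bigon ?_; decide)
    | (refine same_flip_iff.2 ?_; decide)
    | (refine same_curlLeft ?_ ?_ <;> decide)
    | (refine same_curlRight ?_ ?_ <;> decide)

/-- A move of type V is needed. -/
theorem exists_mem_RV {S : Set Move} (h : GeneratedBy .m5a S) : ∃ m ∈ RV, m ∈ S := by
  by_contra! hS
  have := isotopyInvariant_intersectionColoring.same_of_connected
    (fun m hm => same_intersectionColoring fun hm' => hS m hm' hm) h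
  -- For strands coloured `true` and `false`, the singular crossing has weight 1 on exactly one side
  -- of the move.
  exact absurd (same_flip_iff.1 this) (by decide)

/-- A move in which a strand passes over a singular crossing is needed. -/
theorem exists_mem_RIVO {S : Set Move} (h : GeneratedBy .m4d S) : ∃ m ∈ RIVO, m ∈ S := by
  by_contra! hS
  have := (isotopyInvariant_passageColoring false).same_of_connected
    (fun m hm => same_passageColoring_false fun hm' => hS m hm' hm) h
  -- With the middle strand coloured `none` and the others by numbers, the weights of the two sides
  -- differ by 2 modulo 3.
  exact absurd (same_triangle_iff.1 this) (by decide)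

/-- A move in which a strand passes under a singular crossing is needed. -/
theorem exists_mem_RIVU {S : Set Move} (h : GeneratedBy .m4h S) : ∃ m ∈ RIVU, m ∈ S := by
  by_contra! hS
  have := (isotopyInvariant_passageColoring true).same_of_connected
    (fun m hm => same_passageColoring_true fun hm' => hS m hm' hm) h
  exact absurd (same_triangle_iff.1 this) (by decide)

/-! ## Diagrams without singular crossings -/

/-- The piece is not a singular crossing. -/
def Piece.IsOrdinary : Piece → Prop
  | .cross .singular _ _ => False
  | _ => True

/-- The diagram has no singular crossing. -/
def Diagram.IsOrdinary {u v : Word} (d : Diagram u v) : Prop := ∀ L ∈ d.layers, L.piece.IsOrdinary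

theorem isOrdinary_iff_of_isotopy {u v : Word} {d e : Diagram u v} (h : ElementaryIsotopy d e) :
    d.IsOrdinary ↔ e.IsOrdinary := by
  cases h with
  | exchange d e =>
    simp only [Diagram.IsOrdinary, Diagram.stack, Diagram.addLeft, Diagram.addRight,
      List.forall_mem_append, List.forall_mem_map]
    exact and_comm
  | cancelRight a => simp [Diagram.IsOrdinary, Diagram.vertical, Piece.IsOrdinary]
  | cancelLeft a => simp [Diagram.IsOrdinary, Diagram.vertical, Piece.IsOrdinary]
  | throughCap k a b => cases k <;> simp [Diagram.IsOrdinary, Piece.IsOrdinary, Kind.turn]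
  | throughCup k a b => cases k <;> simp [Diagram.IsOrdinary, Piece.IsOrdinary, Kind.turn]

theorem isOrdinary_of_mem_R {m : Move} (hm : m ∈ R) :
    m.toLocalMove.before.IsOrdinary ∧ m.toLocalMove.after.IsOrdinary := by
  cases m <;> first
    | (simp [R, RI, RII, RIII] at hm; done)
    | simp [Diagram.IsOrdinary, Piece.IsOrdinary, Move.toLocalMove, curlLeft, curlRight, bigon,
        triangle, Diagram.vertical, Kind.turn]

theorem not_isOrdinary_of_notMem_R {m : Move} (hm : m ∉ R) :
    ¬ m.toLocalMove.before.IsOrdinary ∧ ¬ m.toLocalMove.after.IsOrdinary := by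
  cases m <;> first
    | (refine absurd ?_ hm; simp [R, RI, RII, RIII]; done)
    | simp [Diagram.IsOrdinary, Piece.IsOrdinary, Move.toLocalMove, flip, triangle]

/-- Moves that involve a singular crossing do not help to connect diagrams without them. -/
theorem Connected.ordinary {S : Set Move} {u v : Word} {d e : Diagram u v} (h : Connected S d e) :
    (d.IsOrdinary ↔ e.IsOrdinary) ∧ (d.IsOrdinary → Connected (S ∩ R) d e) := by
  -- The equivalence is proved along with the implication because symmetry and transitivity need the
  -- other diagrams to be ordinary as well.
  induction h with
  | isotopy h => exact ⟨isOrdinary_iff_of_isotopy h, fun _ => .isotopy h⟩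
  | @move m hm =>
    by_cases hR : m ∈ R
    · exact ⟨iff_of_true (isOrdinary_of_mem_R hR).1 (isOrdinary_of_mem_R hR).2,
        fun _ => .move ⟨hm, hR⟩⟩
    · have := not_isOrdinary_of_notMem_R hR
      exact ⟨iff_of_false this.1 this.2, fun h => absurd h this.1⟩
  | addLeft l _ ih =>
    simp only [Diagram.IsOrdinary, Diagram.addLeft, List.forall_mem_map] at ih ⊢
    exact ⟨ih.1, fun h => (ih.2 h).addLeft l⟩
  | addRight r _ ih =>
    simp only [Diagram.IsOrdinary, Diagram.addRight, List.forall_mem_map] at ih ⊢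
    exact ⟨ih.1, fun h => (ih.2 h).addRight r⟩
  | stack _ _ ih ih' =>
    simp only [Diagram.IsOrdinary, Diagram.stack, List.forall_mem_append] at ih ih' ⊢
    exact ⟨and_congr ih.1 ih'.1, fun h => (ih.2 h.1).stack (ih'.2 h.2)⟩
  | refl d => exact ⟨.rfl, fun _ => .refl d⟩
  | symm _ ih => exact ⟨ih.1.symm, fun h => (ih.2 (ih.1.2 h)).symm⟩
  | trans _ _ ih ih' =>
    exact ⟨ih.1.trans ih'.1, fun h => (ih.2 h).trans (ih'.2 (ih.1.1 h))⟩

/-! ## Generating sets -/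

theorem Connected.of_generatedBy {S T : Set Move} (hS : ∀ m ∈ S, GeneratedBy m T) {u v : Word}
    {d e : Diagram u v} (h : Connected S d e) : Connected T d e := by
  induction h with
  | isotopy h => exact .isotopy h
  | move h => exact hS _ h
  | addLeft l _ ih => exact ih.addLeft l
  | addRight r _ ih => exact ih.addRight r
  | stack _ _ ih ih' => exact ih.stack ih'
  | refl d => exact .refl d
  | symm _ ih => exact ih.symm
  | trans _ _ ih ih' => exact ih.trans ih'

theorem GeneratedBy.mono {S T : Set Move} (h : S ⊆ T) {m : Move} (hm : GeneratedBy m S) :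
    GeneratedBy m T := hm.of_generatedBy fun _ hn => .move (h hn)

theorem IsGeneratingSet.mono {S S' T : Set Move} (h : IsGeneratingSet T S) (hS : S ⊆ S')
    (hT : S' ⊆ T) : IsGeneratingSet T S' := ⟨hT, fun m hm => (h.2 m hm).mono hS⟩

/-- A generating subset missing some `m` lies in `S \ {m}`, which would then generate too. Both
directions of the classification use this form of minimality. -/
theorem IsMinimalGeneratingSet.eq_of_subset {S S' T : Set Move} (h : IsMinimalGeneratingSet T S)
    (h' : IsGeneratingSet T S') (hS : S' ⊆ S) : S' = S := by
  refine hS.antisymm fun m hm => by_contra fun hm' => h.2 m hm ?_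
  exact h'.mono (fun n hn => ⟨hS hn, fun e => hm' (e ▸ hn)⟩) (Set.sdiff_subset.trans h.1.1)

theorem IsGeneratingSet.inter_R {S : Set Move} (h : IsGeneratingSet (R ∪ SR) S) :
    IsGeneratingSet R (S ∩ R) :=
  ⟨Set.inter_subset_right, fun m hm => (h.2 m (.inl hm)).ordinary.2 (isOrdinary_of_mem_R hm).1⟩

theorem realizes_over {S : Set Move} (hR : ∀ m ∈ R, GeneratedBy m S) {x : Move} (hx : x ∈ RIVO)
    (hxS : x ∈ S) (a b c : Bool) : Realizes S (triangle a b c .leftOver .singular .rightOver) := by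
  have h : GeneratedBy x S := .move hxS
  rcases hx with rfl | rfl | rfl | rfl <;>
    exact Realizes.triangle_all hR (k := .rightOver) nofun h a b c

theorem realizes_under {S : Set Move} (hR : ∀ m ∈ R, GeneratedBy m S) {x : Move} (hx : x ∈ RIVU)
    (hxS : x ∈ S) (a b c : Bool) : Realizes S (triangle a b c .rightOver .singular .leftOver) := by
  have h : GeneratedBy x S := .move hxS
  rcases hx with rfl | rfl | rfl | rfl <;>
    exact Realizes.triangle_all hR (k := .leftOver) nofun h a b c

/-- The sufficiency half. Type IV comes before type V, since the quarter turn of a type V move uses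
passages both over and under. -/
theorem generatedBy_of_mem {S : Set Move} (hR : ∀ m ∈ R, GeneratedBy m S) {x y z : Move}
    (hx : x ∈ RIVO) (hy : y ∈ RIVU) (hz : z ∈ RV) (hxS : x ∈ S) (hyS : y ∈ S) (hzS : z ∈ S)
    {m : Move} (hm : m ∈ R ∪ SR) : GeneratedBy m S := by
  have hO := realizes_over hR hx hxS
  have hU := realizes_under hR hy hyS
  have hT : ∀ a b c k, k ≠ .singular → Realizes S (triangle a b c k k .singular) := by
    intro a b c k hk
    cases k
    · exact (hO true true true).triangle_first hR (k := .rightOver) nofun a b c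
    · exact (hU true true true).triangle_first hR (k := .leftOver) nofun a b c
    · exact absurd rfl hk
  have hV : ∀ a b k, k ≠ .singular → Realizes S (flip a b k) := by
    intro a b k hk
    have h : GeneratedBy z S := .move hzS
    rcases hz with rfl | rfl | rfl | rfl | rfl | rfl
    · exact Realizes.flip_all hR hT (k := .rightOver) nofun h a b hk
    · exact Realizes.flip_all hR hT (k := .rightOver) nofun h a b hk
    · exact Realizes.flip_all hR hT (k := .rightOver) nofun h a b hk
    · exact Realizes.flip_all hR hT (k := .leftOver) nofun h a b hk
    · exact Realizes.flip_all hR hT (k := .leftOver) nofun h a b hk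
    · exact Realizes.flip_all hR hT (k := .leftOver) nofun h a b hk
  rcases hm with hm | (hm | hm) | hm
  · exact hR m hm
  · rcases hm with rfl | rfl | rfl | rfl <;> exact hO _ _ _
  · rcases hm with rfl | rfl | rfl | rfl <;> exact hU _ _ _
  · rcases hm with rfl | rfl | rfl | rfl | rfl | rfl <;> exact hV _ _ _ nofun

/-- The type of a move. -/
inductive MoveClass
  | ordinary | over | under | flip

/-- The type of a move, where the moves that do not involve a singular crossing are put together. -/
def Move.cls : Move → MoveClass
  | .m4a | .m4b | .m4c | .m4d => .over
  | .m4e | .m4f | .m4g | .m4h => .under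
  | .m5a | .m5b | .m5c | .m5d | .m5e | .m5f => .flip
  | _ => .ordinary

/-- Through `Move.cls`, disjointness of the families becomes distinctness of constructors, which
`simp` decides. -/
theorem mem_R_iff {m : Move} : m ∈ R ↔ m.cls = .ordinary := by
  cases m <;> simp [R, RI, RII, RIII, Move.cls]

theorem mem_RIVO_iff {m : Move} : m ∈ RIVO ↔ m.cls = .over := by
  cases m <;> simp [RIVO, Move.cls]

theorem mem_RIVU_iff {m : Move} : m ∈ RIVU ↔ m.cls = .under := by
  cases m <;> simp [RIVU, Move.cls]

theorem mem_RV_iff {m : Move} : m ∈ RV ↔ m.cls = .flip := by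
  cases m <;> simp [RV, Move.cls]

theorem mem_SR_iff {m : Move} : m ∈ SR ↔ m.cls ≠ .ordinary := by
  cases m <;> simp [SR, RIV, RIVO, RIVU, RV, Move.cls]

/-- Intersecting with the ordinary moves recovers them. -/
theorem union_inter_R {M X : Set Move} (hM : M ⊆ R) (hX : X ⊆ SR) : (M ∪ X) ∩ R = M := by
  ext m
  constructor
  · rintro ⟨h | h, hR⟩
    · exact h
    · exact absurd (mem_R_iff.1 hR) (mem_SR_iff.1 (hX h))
  · exact fun h => ⟨.inl h, hM h⟩

theorem triple_subset_SR {x y z : Move} (hx : x ∈ RIVO) (hy : y ∈ RIVU) (hz : z ∈ RV) :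
    ({x, y, z} : Set Move) ⊆ SR := by
  rintro m (rfl | rfl | rfl)
  exacts [.inl (.inl hx), .inl (.inr hy), .inr hz]

/-! ### Minimal generating sets containing singular moves, and their number -/

theorem isGeneratingSet_union {M : Set Move} (hM : IsGeneratingSet R M) {x y z : Move}
    (hx : x ∈ RIVO) (hy : y ∈ RIVU) (hz : z ∈ RV) : IsGeneratingSet (R ∪ SR) (M ∪ {x, y, z}) :=
  ⟨Set.union_subset_union hM.1 (triple_subset_SR hx hy hz), fun _ hm =>
    generatedBy_of_mem (fun n hn => (hM.2 n hn).mono Set.subset_union_left) hx hy hz (by simp)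
      (by simp) (by simp) hm⟩

theorem isMinimalGeneratingSet_union {M : Set Move} (hM : IsMinimalGeneratingSet R M)
    {x y z : Move} (hx : x ∈ RIVO) (hy : y ∈ RIVU) (hz : z ∈ RV) :
    IsMinimalGeneratingSet (R ∪ SR) (M ∪ {x, y, z}) := by
  refine ⟨isGeneratingSet_union hM.1 hx hy hz, fun m hm hgen => ?_⟩
  have hMR : ∀ {n}, n ∈ M → n.cls = .ordinary := fun h => mem_R_iff.1 (hM.1.1 h)
  have hx' := mem_RIVO_iff.1 hx
  have hy' := mem_RIVU_iff.1 hy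
  have hz' := mem_RV_iff.1 hz
  rcases hm with hm | rfl | rfl | rfl
  -- The ordinary part of what remains lies in `M \ {m}` and still generates `R`, against the
  -- minimality of `M`.
  · refine hM.2 m hm (hgen.inter_R.mono ?_ (Set.sdiff_subset.trans hM.1.1))
    rintro n ⟨⟨hn, hne⟩, hnR⟩
    exact ⟨(union_inter_R hM.1.1 (triple_subset_SR hx hy hz)).subset ⟨hn, hnR⟩, hne⟩
  -- What remains still generates `m4d`, so it contains a move over a singular crossing; the only
  -- such move in the union was the one removed.
  · obtain ⟨n, hn, hn' | rfl | rfl | rfl, hne⟩ :=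
      exists_mem_RIVO (hgen.2 .m4d (.inr (.inl (.inl (by simp [RIVO]))))) <;>
      simp_all [mem_RIVO_iff]
  · obtain ⟨n, hn, hn' | rfl | rfl | rfl, hne⟩ :=
      exists_mem_RIVU (hgen.2 .m4h (.inr (.inl (.inr (by simp [RIVU]))))) <;>
      simp_all [mem_RIVU_iff]
  · obtain ⟨n, hn, hn' | rfl | rfl | rfl, hne⟩ :=
      exists_mem_RV (hgen.2 .m5a (.inr (.inr (by simp [RV])))) <;>
      simp_all [mem_RV_iff]

/-- The invariants provide one move of each singular family in `S`. Together with `S ∩ R` they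
already generate, so by minimality they exhaust `S`. -/
theorem IsMinimalGeneratingSet.exists_eq_union {S : Set Move}
    (h : IsMinimalGeneratingSet (R ∪ SR) S) : IsMinimalGeneratingSet R (S ∩ R) ∧
      ∃ x ∈ RIVO, ∃ y ∈ RIVU, ∃ z ∈ RV, S = S ∩ R ∪ {x, y, z} := by
  obtain ⟨x, hx, hxS⟩ := exists_mem_RIVO (h.1.2 .m4d (.inr (.inl (.inl (by simp [RIVO])))))
  obtain ⟨y, hy, hyS⟩ := exists_mem_RIVU (h.1.2 .m4h (.inr (.inl (.inr (by simp [RIVU])))))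
  obtain ⟨z, hz, hzS⟩ := exists_mem_RV (h.1.2 .m5a (.inr (.inr (by simp [RV]))))
  have hxyz : ({x, y, z} : Set Move) ⊆ S := by
    rintro m (rfl | rfl | rfl) <;> assumption
  refine ⟨⟨h.1.inter_R, fun m hm hgen => ?_⟩, x, hx, y, hy, z, hz, ?_⟩
  -- If `m` were superfluous in `S ∩ R`, the smaller ordinary part and the three singular moves
  -- would generate, hence equal `S`, although `m` is missing.
  · have := h.eq_of_subset (isGeneratingSet_union hgen hx hy hz)
      (Set.union_subset (Set.sdiff_subset.trans Set.inter_subset_left) hxyz)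
    rw [← this] at hm
    rcases hm.1 with hm' | hm'
    · exact hm'.2 rfl
    · exact mem_SR_iff.1 (triple_subset_SR hx hy hz hm') (mem_R_iff.1 hm.2)
  · exact (h.eq_of_subset (isGeneratingSet_union h.1.inter_R hx hy hz)
      (Set.union_subset Set.inter_subset_left hxyz)).symm

theorem isMinimalGeneratingSet_and_subset_iff {M : Set Move} (hM : IsMinimalGeneratingSet R M)
    (S : Set Move) : IsMinimalGeneratingSet (R ∪ SR) S ∧ M ⊆ S ↔
      ∃ x ∈ RIVO, ∃ y ∈ RIVU, ∃ z ∈ RV, S = M ∪ {x, y, z} := by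
  constructor
  · rintro ⟨h, hMS⟩
    obtain ⟨hR, x, hx, y, hy, z, hz, hS⟩ := h.exists_eq_union
    -- `M` generates `R` and lies in the minimal generating set `S ∩ R`, so the two coincide.
    rw [← hR.eq_of_subset hM.1 (Set.subset_inter hMS hM.1.1)] at hS
    exact ⟨x, hx, y, hy, z, hz, hS⟩
  · rintro ⟨x, hx, y, hy, z, hz, rfl⟩
    exact ⟨isMinimalGeneratingSet_union hM hx hy hz, Set.subset_union_left⟩

theorem union_left_cancel {M X Y : Set Move} (hM : M ⊆ R) (hX : X ⊆ SR) (hY : Y ⊆ SR)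
    (h : M ∪ X = M ∪ Y) : X = Y := by
  have aux : ∀ {X Y : Set Move}, X ⊆ SR → M ∪ X = M ∪ Y → X ⊆ Y := by
    intro X Y hX h m hm
    rcases h.subset (.inr hm) with h' | h'
    · exact absurd (mem_R_iff.1 (hM h')) (mem_SR_iff.1 (hX hm))
    · exact h'
  exact (aux hX h).antisymm (aux hY h.symm)

theorem triple_injective {x y z x' y' z' : Move} (hx : x ∈ RIVO) (hy : y ∈ RIVU) (hz : z ∈ RV)
    (hx' : x' ∈ RIVO) (hy' : y' ∈ RIVU) (hz' : z' ∈ RV)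
    (h : ({x, y, z} : Set Move) = {x', y', z'}) : x = x' ∧ y = y' ∧ z = z' := by
  rw [mem_RIVO_iff] at hx hx'
  rw [mem_RIVU_iff] at hy hy'
  rw [mem_RV_iff] at hz hz'
  refine ⟨?_, ?_, ?_⟩
  · rcases h.subset (show x ∈ _ by simp) with e | e | e <;> simp_all
  · rcases h.subset (show y ∈ _ by simp) with e | e | e <;> simp_all
  · rcases h.subset (show z ∈ _ by simp) with e | e | e <;> simp_all

theorem ncard_isMinimalGeneratingSet {M : Set Move} (hM : IsMinimalGeneratingSet R M) :
    {S : Set Move | IsMinimalGeneratingSet (R ∪ SR) S ∧ M ⊆ S}.ncard = 4 * 4 * 6 := by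
  have hset : {S : Set Move | IsMinimalGeneratingSet (R ∪ SR) S ∧ M ⊆ S} =
      (fun t : Move × Move × Move => M ∪ {t.1, t.2.1, t.2.2}) '' (RIVO ×ˢ RIVU ×ˢ RV) := by
    ext S
    rw [Set.mem_ofPred_eq, isMinimalGeneratingSet_and_subset_iff hM]
    constructor
    · rintro ⟨x, hx, y, hy, z, hz, rfl⟩
      exact ⟨(x, y, z), ⟨hx, hy, hz⟩, rfl⟩
    · rintro ⟨⟨x, y, z⟩, ⟨hx, hy, hz⟩, rfl⟩
      exact ⟨x, hx, y, hy, z, hz, rfl⟩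
  have hO : RIVO.ncard = 4 := by simp [RIVO, Set.ncard_insert_of_notMem]
  have hU : RIVU.ncard = 4 := by simp [RIVU, Set.ncard_insert_of_notMem]
  have hV : RV.ncard = 6 := by simp [RV, Set.ncard_insert_of_notMem]
  -- The remaining goal is injectivity: the ordinary part cancels, and each element of the triple is
  -- recovered from its family.
  rw [hset, Set.InjOn.ncard_image, Set.ncard_prod, Set.ncard_prod, hO, hU, hV]
  · rintro ⟨x, y, z⟩ ⟨hx, hy, hz⟩ ⟨x', y', z'⟩ ⟨hx', hy', hz'⟩ h
    obtain ⟨rfl, rfl, rfl⟩ := triple_injective hx hy hz hx' hy' hz' (union_left_cancel hM.1.1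
      (triple_subset_SR hx hy hz) (triple_subset_SR hx' hy' hz') h)
    rfl

end SingularTangle

open SingularTangle in
theorem theorem1p1 :
    (∀ S : Set Move, IsMinimalGeneratingSet (R ∪ SR) S ↔
      ∃ M : Set Move, IsMinimalGeneratingSet R M ∧
        ∃ x ∈ RIVO, ∃ y ∈ RIVU, ∃ z ∈ RV, S = M ∪ {x, y, z}) ∧
    (∀ M : Set Move, IsMinimalGeneratingSet R M →
      (∀ S : Set Move, IsMinimalGeneratingSet (R ∪ SR) S ∧ M ⊆ S ↔
        ∃ x ∈ RIVO, ∃ y ∈ RIVU, ∃ z ∈ RV, S = M ∪ {x, y, z}) ∧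
      (∀ X : Set Move, X ⊆ SR → (IsMinimalGeneratingSet (R ∪ SR) (M ∪ X) ↔
        ∃ x ∈ RIVO, ∃ y ∈ RIVU, ∃ z ∈ RV, X = {x, y, z})) ∧
      {S : Set Move | IsMinimalGeneratingSet (R ∪ SR) S ∧ M ⊆ S}.ncard = 4 * 4 * 6) := by
  refine ⟨fun S => ⟨fun h => ⟨_, h.exists_eq_union⟩, ?_⟩, fun M hM =>
    ⟨isMinimalGeneratingSet_and_subset_iff hM, fun X hX => ⟨fun h => ?_, ?_⟩,
      ncard_isMinimalGeneratingSet hM⟩⟩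
  · rintro ⟨M, hM, x, hx, y, hy, z, hz, rfl⟩
    exact isMinimalGeneratingSet_union hM hx hy hz
  · obtain ⟨x, hx, y, hy, z, hz, h'⟩ :=
      (isMinimalGeneratingSet_and_subset_iff hM _).1 ⟨h, Set.subset_union_left⟩
    exact ⟨x, hx, y, hy, z, hz, union_left_cancel hM.1.1 hX (triple_subset_SR hx hy hz) h'⟩
  · rintro ⟨x, hx, y, hy, z, hz, rfl⟩
    exact isMinimalGeneratingSet_union hM hx hy hz
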